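/- Let $N\ge 1$, let $B=[b_{ij}]\in\mathbb{R}^{N\times N}$ with $b_{ii}=0$ be the adjacency matrix of a strongly connected signed digraph (there is an edge $(i,j)$ when $b_{ij}\neq0$; weights may be positive or negative), let $\sigma_1,\dots,\sigma_N>0$, $\Sigma=\mathrm{diag}(\sigma_1,\dots,\sigma_N)$, $E=B-\Sigma$, and consider the system $$\dot x=A(x)Ex,\qquad A(x)=\tfrac12\,(I-\mathrm{diag}(x)),$$ whose agent states are meant to take values in $[-1,1]$. Let $\rho$ denote the spectral radius. A real square matrix $M$ is called eventually positive if there is an integer $k_0\geq 1$ such that $M^k$ is entrywise positive for all $k\ge k_0$. Write $H(M)=\frac12(M+M^{\mathrm T})$. Inequalities between vectors are componentwise (strict inequalities strict in every component), and $\|v\|_\infty=\max_i|v_i|$. Suppose that one of the following two assumptions holds. * Assumption 1: $B$ is eventually positive and $\sigma_1=\dots=\sigma_N=:d\ge\rho(B)$; in this case put $C=B$. * Assumption 2: $B$ is not eventually positive, and $E=C-dI$ with $d\in\mathbb{R}$, where $C=B+(dI-\Sigma)$ is eventually positive and $d\ge\rho(C)$. Suppose moreover that there is a diagonal matrix $\Gamma=\mathrm{diag}(\gamma_1,\dots,\gamma_N)$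 with all $\gamma_i>0$ such that $H(\Gamma E)\preceq0$ and $\mathrm{rank}\,H(\Gamma E)=\mathrm{rank}\,E$. Let $v_r$ be a positive right eigenvector of $C$ for the eigenvalue $\rho(C)$. Below, a solution is a solution on $[0,\infty)$. Then: 1. If a solution satisfies $x(0)<\mathbf 1$, then $\lim_{t\to\infty}x(t)=\alpha v_r$ for some $\alpha<\frac1{\|v_r\|_\infty}$. If moreover $x(t)\in[-1,1]^N$ for all $t\ge0$, then $\alpha\in\big[-\frac1{\|v_r\|_\infty},\frac1{\|v_r\|_\infty}\big)$. 2. Let $S\subset\{1,\dots,N\}$ be nonempty and not the whole set. Let $\bar E_{22}$ be the submatrix of $E$ with rows and columns outside $S$, and $\bar E_{21}$ the submatrix with rows outside $S$ and columns in $S$. Suppose that $\bar E_{22}$ is nonsingular and $-\mathbf 1\le-\bar E_{22}^{-1}\bar E_{21}\mathbf 1<\mathbf 1$. Let $x^*$ be the point whose components in $S$ equal $1$ and whose components outside $S$ are those of $-\bar E_{22}^{-1}\bar E_{21}\mathbf 1$. Then $x^*$ is an equilibrium of the system, and every solution with $x_i(0)=1$ for $i\in S$ and $x_i(0)\in[-1,1)$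 for $i\notin S$ converges to $x^*$ as $t\to\infty$. 3. Suppose that $d=\rho(C)$ (under Assumption 1: $\sigma_i=\rho(B)$ for all $i$) and $v_r\ne\mathbf 1$, and let $\mathcal J=\{j: v_{r,j}=\|v_r\|_\infty\}$. Then every solution with $x_i(0)=1$ for $i\in\mathcal J$ and $x_i(0)\in[-1,1)$ for $i\notin\mathcal J$ converges to $v_r/\|v_r\|_\infty$ as $t\to\infty$. -/

import Mathlib

open Filter Topology

noncomputable section

namespace OpinionDynamics

/-- Edge relation of the signed digraph with adjacency matrix `B`: there is an edge from `i` to `j`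
when `B i j ≠ 0` (positive weight: friendly, negative weight: antagonistic). -/
def Edge {N : ℕ} (B : Matrix (Fin N) (Fin N) ℝ) (i j : Fin N) : Prop := B i j ≠ 0

/-- Any two distinct nodes are joined by a directed path. -/
def StronglyConnected {N : ℕ} (B : Matrix (Fin N) (Fin N) ℝ) : Prop :=
  ∀ i j : Fin N, i ≠ j → Relation.TransGen (Edge B) i j

/-- All sufficiently large powers of the matrix are entrywise positive. -/
def EventuallyPositive {N : ℕ} (M : Matrix (Fin N) (Fin N) ℝ) : Prop :=
  ∃ k₀ : ℕ, 0 < k₀ ∧ ∀ k : ℕ, k₀ ≤ k → ∀ i j : Fin N, 0 < (M ^ k) i j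

/-- Spectral radius of a real matrix: the largest modulus of its complex eigenvalues. -/
def specRadius {N : ℕ} (M : Matrix (Fin N) (Fin N) ℝ) : ℝ :=
  (spectralRadius ℂ (M.map (algebraMap ℝ ℂ))).toReal

/-- `v` is an entrywise positive right eigenvector of `M` for the eigenvalue `ρ(M)`. -/
def IsPerronVector {N : ℕ} (M : Matrix (Fin N) (Fin N) ℝ) (v : Fin N → ℝ) : Prop :=
  (∀ i, 0 < v i) ∧ M.mulVec v = specRadius M • v

/-- Symmetric part `H(M) = (M + Mᵀ) / 2`. -/
def symPart {N : ℕ} (M : Matrix (Fin N) (Fin N) ℝ) : Matrix (Fin N) (Fin N) ℝ :=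
  (1 / 2 : ℝ) • (M + M.transpose)

/-- `M ⪯ 0` for a symmetric matrix. -/
def NegSemidef {N : ℕ} (M : Matrix (Fin N) (Fin N) ℝ) : Prop := (-M).PosSemidef

/-- The matrix `E = B - Σ` with `Σ = diag(σ₁, …, σ_N)`. -/
def systemMatrix {N : ℕ} (B : Matrix (Fin N) (Fin N) ℝ) (σ : Fin N → ℝ) :
    Matrix (Fin N) (Fin N) ℝ :=
  B - Matrix.diagonal σ

/-- `B` is eventually positive and all `σ i` are equal to one number that is at least `ρ(B)`. -/
def Assumption1 {N : ℕ} (B : Matrix (Fin N) (Fin N) ℝ) (σ : Fin N → ℝ) : Prop :=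
  EventuallyPositive B ∧ ∀ i j : Fin N, σ i = σ j ∧ specRadius B ≤ σ i

/-- `B` is not eventually positive, and `E = C - d I` where `C = B + (d I - Σ)` is eventually
positive and `d ≥ ρ(C)`. -/
def Assumption2 {N : ℕ} (B : Matrix (Fin N) (Fin N) ℝ) (σ : Fin N → ℝ)
    (C : Matrix (Fin N) (Fin N) ℝ) (d : ℝ) : Prop :=
  ¬ EventuallyPositive B ∧
    C = B + (d • (1 : Matrix (Fin N) (Fin N) ℝ) - Matrix.diagonal σ) ∧
    EventuallyPositive C ∧ specRadius C ≤ d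

/-- Susceptibility matrix of the stubborn positives scenario, `A(x) = 0.5 (I - diag x)`. -/
def susceptibility {N : ℕ} (x : Fin N → ℝ) : Matrix (Fin N) (Fin N) ℝ :=
  (1 / 2 : ℝ) • (1 - Matrix.diagonal x)

/-- The vector field `A(x) E x`. -/
def opinionField {N : ℕ} (E : Matrix (Fin N) (Fin N) ℝ) (x : Fin N → ℝ) : Fin N → ℝ :=
  (susceptibility x).mulVec (E.mulVec x)

/-- `x` solves `ẋ = A(x) E x` on `[0, ∞)` (one-sided derivative at `0`). -/
def IsSolution {N : ℕ} (E : Matrix (Fin N) (Fin N) ℝ) (x : ℝ → Fin N → ℝ) : Prop :=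
  ∀ t : ℝ, 0 ≤ t → HasDerivWithinAt x (opinionField E (x t)) (Set.Ici 0) t

/-- The block of `E` with rows and columns outside the frozen set `S`. -/
def freeBlock {N : ℕ} (E : Matrix (Fin N) (Fin N) ℝ) (S : Finset (Fin N)) :
    Matrix {i : Fin N // i ∉ S} {i : Fin N // i ∉ S} ℝ :=
  E.toBlock (fun i => i ∉ S) (fun i => i ∉ S)

/-- The block of `E` with rows outside the frozen set `S` and columns in `S`. -/
def couplingBlock {N : ℕ} (E : Matrix (Fin N) (Fin N) ℝ) (S : Finset (Fin N)) :
    Matrix {i : Fin N // i ∉ S} {i : Fin N // i ∈ S} ℝ :=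
  E.toBlock (fun i => i ∉ S) (fun i => i ∈ S)

/-- The vector `- E₂₂⁻¹ E₂₁ 𝟏`, where `E₂₂` is the free block and `E₂₁` the coupling block. -/
def freeEquilibrium {N : ℕ} (E : Matrix (Fin N) (Fin N) ℝ) (S : Finset (Fin N)) :
    {i : Fin N // i ∉ S} → ℝ :=
  -((freeBlock E S)⁻¹.mulVec ((couplingBlock E S).mulVec (fun _ => 1)))

/-- The point `x*` that is `1` on the frozen set `S` and `- E₂₂⁻¹ E₂₁ 𝟏` outside it. -/
def frozenEquilibrium {N : ℕ} (E : Matrix (Fin N) (Fin N) ℝ) (S : Finset (Fin N)) :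
    Fin N → ℝ :=
  fun i => if h : i ∈ S then 1 else freeEquilibrium E S ⟨i, h⟩

end OpinionDynamics

end

open OpinionDynamics

/-!
Fix an equilibrium `p` with `pᵢ = 1` for `i ∈ S`, and `pᵢ < 1`, `(E p)ᵢ = 0` for `i ∉ S`. Since
`1 - xᵢ` solves a linear scalar equation along a solution, the coordinates in `S` stay equal to `1`
and the others stay below `1`. On the latter, the function
`∑ γᵢ (1 - pᵢ) g((1 - xᵢ) / (1 - pᵢ))` with `g u = u - 1 - log u` has derivative
`(x - p)ᵀ Γ E (x - p) / 2 ≤ 0`: the factor `1 - xᵢ` of the vector field cancels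
(`hasDerivWithinAt_lyapunov`). It blows up at `xᵢ = 1` and at `-∞`, so the solution stays in a
compact box away from `xᵢ = 1`, and being bounded below it decreases arbitrarily slowly at
arbitrarily late times. A limit point `q` along such times satisfies
`(q - p)ᵀ H(ΓE) (q - p) = 0`, hence `E (q - p) = 0` by the rank condition
(`mulVec_eq_zero_of_sum_weighted_eq_zero`). So `q` is an equilibrium of the same kind, and the
function centred at `q` is nonincreasing and tends to `0` along a sequence of times; this forces
`x t → q` (`IsSolution.exists_tendsto`). No invariance principle is needed.

It remains to identify `q`. By a Perron–Frobenius argument the kernel of `E = C - d I` is contained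
in the line through `v` (`EventuallyPositive.exists_eq_smul`), which settles the case
`S = ∅`, `p = 0`. If the free block is nonsingular, `q - p`, which vanishes on `S`, is zero. In the
critical case `q - p` is a multiple of `v > 0` that vanishes on the nonempty set where `v` is
largest, so it is zero too.
-/

namespace OpinionDynamics

open Matrix

variable {N : ℕ}

/-! ### The quadratic form of the system matrix -/

lemma dotProduct_symPart_mulVec (M : Matrix (Fin N) (Fin N) ℝ) (y : Fin N → ℝ) :
    y ⬝ᵥ (symPart M *ᵥ y) = y ⬝ᵥ (M *ᵥ y) := by
  have h : y ⬝ᵥ (Mᵀ *ᵥ y) = y ⬝ᵥ (M *ᵥ y) := by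
    rw [mulVec_transpose, dotProduct_comm, dotProduct_mulVec]
  rw [symPart, smul_mulVec, add_mulVec, dotProduct_smul, dotProduct_add, h, smul_eq_mul]
  ring

lemma dotProduct_diagonal_mul_mulVec (γ : Fin N → ℝ) (E : Matrix (Fin N) (Fin N) ℝ)
    (y : Fin N → ℝ) :
    y ⬝ᵥ ((diagonal γ * E) *ᵥ y) = ∑ i, γ i * y i * (E *ᵥ y) i := by
  rw [← mulVec_mulVec]
  simp only [dotProduct, mulVec_diagonal]
  exact Finset.sum_congr rfl fun i _ => by ring

lemma sum_weighted_nonpos {γ : Fin N → ℝ} {E : Matrix (Fin N) (Fin N) ℝ}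
    (hneg : NegSemidef (symPart (diagonal γ * E))) (y : Fin N → ℝ) :
    ∑ i, γ i * y i * (E *ᵥ y) i ≤ 0 := by
  have h := hneg.dotProduct_mulVec_nonneg y
  rw [star_trivial, neg_mulVec, dotProduct_neg, dotProduct_symPart_mulVec,
    dotProduct_diagonal_mul_mulVec] at h
  linarith

/-- The rank condition makes the isotropic vectors of `H(ΓE)` exactly the kernel of `E`: the kernel
of `E` always lies in that of `H(ΓE)`, and the two have the same dimension. -/
lemma mulVec_eq_zero_of_sum_weighted_eq_zero {γ : Fin N → ℝ} {E : Matrix (Fin N) (Fin N) ℝ}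
    (hneg : NegSemidef (symPart (diagonal γ * E)))
    (hrank : (symPart (diagonal γ * E)).rank = E.rank)
    {y : Fin N → ℝ} (hy : ∑ i, γ i * y i * (E *ᵥ y) i = 0) : E *ᵥ y = 0 := by
  set H := symPart (diagonal γ * E) with hH
  have key : ∀ z : Fin N → ℝ, ∑ i, γ i * z i * (E *ᵥ z) i = 0 → H *ᵥ z = 0 := by
    intro z hz
    have h := (hneg.dotProduct_mulVec_zero_iff z).1 (by
      rw [star_trivial, neg_mulVec, dotProduct_neg, hH, dotProduct_symPart_mulVec,
        dotProduct_diagonal_mul_mulVec, hz, neg_zero])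
    rwa [neg_mulVec, neg_eq_zero] at h
  have hle : LinearMap.ker E.mulVecLin ≤ LinearMap.ker H.mulVecLin := by
    intro z hz
    have hz' : E *ᵥ z = 0 := by simpa using hz
    simpa using key z (by simp [hz'])
  have hE := E.mulVecLin.finrank_range_add_finrank_ker
  have hH' := H.mulVecLin.finrank_range_add_finrank_ker
  have heq := Submodule.eq_of_le_of_finrank_eq hle (by
    simp only [Matrix.rank] at hrank
    omega)
  have hmem : y ∈ LinearMap.ker H.mulVecLin := by simpa using key y hy
  rw [← heq] at hmem
  simpa using hmem

/-! ### Eigenvectors of eventually positive matrices -/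

lemma pow_mulVec_of_eigen {M : Matrix (Fin N) (Fin N) ℝ} {v : Fin N → ℝ} {r : ℝ}
    (h : M *ᵥ v = r • v) (k : ℕ) : (M ^ k) *ᵥ v = r ^ k • v := by
  induction k with
  | zero => simp
  | succ k ih => rw [pow_succ, ← mulVec_mulVec, h, mulVec_smul, ih, smul_smul, pow_succ, mul_comm]

/-- A positive eigenvector of an eventually positive matrix spans every eigenspace whose eigenvalue
is at least its own (so all eigenspaces for strictly larger eigenvalues vanish). -/
lemma EventuallyPositive.exists_eq_smul {C : Matrix (Fin N) (Fin N) ℝ}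
    (hC : EventuallyPositive C) [NeZero N] {v q : Fin N → ℝ} {r d : ℝ} (hr : 0 ≤ r) (hrd : r ≤ d)
    (hv : ∀ i, 0 < v i) (hCv : C *ᵥ v = r • v) (hCq : C *ᵥ q = d • q) :
    ∃ α : ℝ, q = α • v := by
  obtain ⟨k, hk, hpos⟩ := hC
  have hP := hpos k le_rfl
  have hPv := pow_mulVec_of_eigen hCv k
  have hPq := pow_mulVec_of_eigen hCq k
  set P := C ^ k
  rcases hrd.eq_or_lt with rfl | hlt
  · -- `q - α v` is nonnegative with a zero entry for the least ratio `α`; positivity of `P` kills it.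
    obtain ⟨i, hi⟩ := Finite.exists_min fun i => q i / v i
    refine ⟨q i / v i, ?_⟩
    set α := q i / v i with hα
    have hw : ∀ j, 0 ≤ (q - α • v) j := fun j => by
      have := (le_div_iff₀ (hv j)).1 (hi j)
      simpa using this
    have hwi : (q - α • v) i = 0 := by
      simp [hα, div_mul_cancel₀ _ (hv i).ne']
    have hPw : ∑ j, P i j * (q - α • v) j = 0 := by
      change (P *ᵥ (q - α • v)) i = 0
      have : P *ᵥ (q - α • v) = r ^ k • (q - α • v) := by
        rw [mulVec_sub, mulVec_smul, hPv, hPq, smul_sub, smul_comm]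
      rw [this, Pi.smul_apply, hwi, smul_zero]
    have hterm := (Finset.sum_eq_zero_iff_of_nonneg
      (fun j _ => mul_nonneg (hP i j).le (hw j))).1 hPw
    funext j
    have h0 := (mul_eq_zero.1 (hterm j (Finset.mem_univ j))).resolve_left (hP i j).ne'
    simpa [sub_eq_zero] using h0
  · -- At an index maximizing `|q| / v`, the bound `|P q| ≤ P |q|` forces `d ^ k ≤ r ^ k`.
    obtain ⟨i, hi⟩ := Finite.exists_max fun i => |q i| / v i
    set m := |q i| / v i with hm
    have hle : ∀ j, |q j| ≤ m * v j := fun j => (div_le_iff₀ (hv j)).1 (hi j)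
    have hqi : |q i| = m * v i := (div_mul_cancel₀ _ (hv i).ne').symm
    have habs : |(P *ᵥ q) i| ≤ ∑ j, |P i j * q j| := by
      rw [mulVec, dotProduct]
      exact Finset.abs_sum_le_sum_abs _ _
    have h1 : d ^ k * |q i| ≤ r ^ k * |q i| := by
      calc d ^ k * |q i| = |(P *ᵥ q) i| := by
            rw [hPq, Pi.smul_apply, smul_eq_mul, abs_mul, abs_of_nonneg (pow_nonneg (hr.trans hrd) k)]
        _ ≤ ∑ j, |P i j * q j| := habs
        _ ≤ ∑ j, m * (P i j * v j) := Finset.sum_le_sum fun j _ => by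
            rw [abs_mul, abs_of_pos (hP i j)]
            calc P i j * |q j| ≤ P i j * (m * v j) :=
                  mul_le_mul_of_nonneg_left (hle j) (hP i j).le
              _ = m * (P i j * v j) := by ring
        _ = m * (P *ᵥ v) i := by rw [← Finset.mul_sum]; rfl
        _ = r ^ k * |q i| := by rw [hPv, hqi, Pi.smul_apply, smul_eq_mul]; ring
    have hpow : r ^ k < d ^ k := pow_lt_pow_left₀ hlt hr hk.ne'
    have hzero : |q i| = 0 := by
      by_contra hne
      have : 0 < |q i| := lt_of_le_of_ne (abs_nonneg _) (Ne.symm hne)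
      nlinarith
    refine ⟨0, funext fun j => ?_⟩
    have := hle j
    rw [hm, hzero, zero_div, zero_mul] at this
    simpa using this

/-! ### Invariance of the faces `xᵢ = 1` -/

lemma opinionField_apply (E : Matrix (Fin N) (Fin N) ℝ) (x : Fin N → ℝ) (i : Fin N) :
    opinionField E x i = 1 / 2 * (1 - x i) * (E *ᵥ x) i := by
  have h : susceptibility x = diagonal fun i => 1 / 2 * (1 - x i) := by
    ext i j
    by_cases hij : i = j <;> simp [susceptibility, hij]
  rw [opinionField, h, mulVec_diagonal]

lemma IsSolution.hasDerivWithinAt_apply {E : Matrix (Fin N) (Fin N) ℝ} {x : ℝ → Fin N → ℝ}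
    (hx : IsSolution E x) {t : ℝ} (ht : 0 ≤ t) (i : Fin N) :
    HasDerivWithinAt (fun s => x s i) (1 / 2 * (1 - x t i) * (E *ᵥ x t) i) (Set.Ici 0) t := by
  rw [← opinionField_apply]
  exact hasDerivWithinAt_pi.1 (hx t ht) i

/-- The equation for `1 - xᵢ` is linear along a solution, so `1 - xᵢ` is its initial value times a
positive factor. -/
lemma IsSolution.exists_one_sub_eq_mul_exp {E : Matrix (Fin N) (Fin N) ℝ} {x : ℝ → Fin N → ℝ}
    (hx : IsSolution E x) (i : Fin N) :
    ∃ A : ℝ → ℝ, ∀ t, 0 ≤ t → 1 - x t i = (1 - x 0 i) * Real.exp (A t) := by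
  have hcont : ContinuousOn x (Set.Ici 0) := fun t ht => (hx t ht).continuousWithinAt
  have hmax : Continuous fun t : ℝ => x (max t 0) :=
    hcont.comp_continuous (by fun_prop) fun t => le_max_right t 0
  -- Freezing `x` for negative times gives a coefficient that is continuous on all of `ℝ`.
  set a : ℝ → ℝ := fun t => -(1 / 2) * (E *ᵥ x (max t 0)) i with ha
  have hac : Continuous a := by
    have : Continuous fun t : ℝ => (E *ᵥ x (max t 0)) :=
      Continuous.matrix_mulVec continuous_const hmax
    exact continuous_const.mul ((continuous_apply i).comp this)
  set A : ℝ → ℝ := fun t => ∫ s in (0 : ℝ)..t, a s with hA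
  have hAd : ∀ t, HasDerivAt A (a t) t := fun t =>
    intervalIntegral.integral_hasDerivAt_right (hac.intervalIntegrable _ _)
      hac.stronglyMeasurable.stronglyMeasurableAtFilter hac.continuousAt
  refine ⟨A, fun t ht => ?_⟩
  set F : ℝ → ℝ := fun s => (1 - x s i) * Real.exp (-A s) with hF
  have hFd : ∀ s, 0 ≤ s → HasDerivWithinAt F 0 (Set.Ici 0) s := fun s hs => by
    have h1 := ((hx.hasDerivWithinAt_apply hs i).const_sub 1).mul
      ((hAd s).neg.exp.hasDerivWithinAt (s := Set.Ici 0))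
    refine h1.congr_deriv ?_
    simp only [ha, max_eq_left hs]
    ring
  have hconst : F t = F 0 := by
    refine constant_of_has_deriv_right_zero (f := F) (a := 0) (b := t)
      (fun s hs => (hFd s hs.1).continuousWithinAt.mono Set.Icc_subset_Ici_self)
      (fun s hs => (hFd s hs.1).mono (Set.Ici_subset_Ici.2 hs.1)) t ⟨ht, le_rfl⟩
  have hA0 : A 0 = 0 := by simp [hA]
  have h2 : (1 - x t i) * Real.exp (-A t) = 1 - x 0 i := by
    simpa [hF, hA0] using hconst
  rw [← h2, mul_assoc, ← Real.exp_add, neg_add_cancel, Real.exp_zero, mul_one]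

lemma IsSolution.eq_one {E : Matrix (Fin N) (Fin N) ℝ} {x : ℝ → Fin N → ℝ}
    (hx : IsSolution E x) {i : Fin N} (h0 : x 0 i = 1) {t : ℝ} (ht : 0 ≤ t) : x t i = 1 := by
  obtain ⟨A, hA⟩ := hx.exists_one_sub_eq_mul_exp i
  have := hA t ht
  rw [h0, sub_self, zero_mul] at this
  linarith

lemma IsSolution.lt_one {E : Matrix (Fin N) (Fin N) ℝ} {x : ℝ → Fin N → ℝ}
    (hx : IsSolution E x) {i : Fin N} (h0 : x 0 i < 1) {t : ℝ} (ht : 0 ≤ t) : x t i < 1 := by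
  obtain ⟨A, hA⟩ := hx.exists_one_sub_eq_mul_exp i
  have h1 := hA t ht
  have h2 := mul_pos (sub_pos.2 h0) (Real.exp_pos (A t))
  linarith

/-! ### The Lyapunov function -/

/-- The entropy-like function `u - 1 - log u`, which on `(0, ∞)` is nonnegative, vanishes only at
`1`, and tends to infinity at both ends. -/
noncomputable def relEntropy (u : ℝ) : ℝ := u - 1 - Real.log u

lemma sq_sqrt_sub_one_le_relEntropy {u : ℝ} (hu : 0 < u) :
    (√u - 1) ^ 2 ≤ relEntropy u := by
  have h1 := Real.log_le_sub_one_of_pos (Real.sqrt_pos.2 hu)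
  rw [Real.log_sqrt hu.le] at h1
  have h2 := Real.sq_sqrt hu.le
  rw [relEntropy]
  nlinarith

lemma relEntropy_nonneg {u : ℝ} (hu : 0 < u) : 0 ≤ relEntropy u :=
  (sq_nonneg _).trans (sq_sqrt_sub_one_le_relEntropy hu)

lemma mem_Icc_of_relEntropy_le {u m : ℝ} (hu : 0 < u) (h : relEntropy u ≤ m) :
    u ∈ Set.Icc (Real.exp (-(m + 1))) ((1 + √m) ^ 2) := by
  constructor
  · rw [← Real.le_log_iff_exp_le hu]
    rw [relEntropy] at h
    linarith
  · have h1 := Real.le_sqrt_of_sq_le ((sq_sqrt_sub_one_le_relEntropy hu).trans h)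
    rw [← Real.sq_sqrt hu.le]
    exact pow_le_pow_left₀ (Real.sqrt_nonneg u) (by linarith) 2

lemma tendsto_one_of_relEntropy {u : ℝ → ℝ} (hpos : ∀ᶠ t in atTop, 0 < u t)
    (h : Tendsto (fun t => relEntropy (u t)) atTop (𝓝 0)) : Tendsto u atTop (𝓝 1) := by
  have h1 : Tendsto (fun t => (√(u t) - 1) ^ 2) atTop (𝓝 0) :=
    tendsto_of_tendsto_of_tendsto_of_le_of_le' tendsto_const_nhds h
      (Eventually.of_forall fun t => sq_nonneg _)
      (hpos.mono fun t ht => sq_sqrt_sub_one_le_relEntropy ht)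
  have h2 : Tendsto (fun t => √(u t) - 1) atTop (𝓝 0) := by
    rw [tendsto_zero_iff_abs_tendsto_zero]
    have := h1.sqrt
    simpa [Real.sqrt_sq_eq_abs, Function.comp_def] using this
  have h3 : Tendsto (fun t => (√(u t) - 1 + 1) ^ 2) atTop (𝓝 ((0 + 1) ^ 2)) :=
    (h2.add_const 1).pow 2
  rw [zero_add, one_pow] at h3
  refine h3.congr' (hpos.mono fun t ht => ?_)
  rw [sub_add_cancel, Real.sq_sqrt ht.le]

/-- The Lyapunov function centred at `q`, over the coordinates outside the frozen set `S`. Its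
partial derivative in `xᵢ` is `γᵢ (xᵢ - qᵢ) / (1 - xᵢ)`, which cancels the susceptibility. -/
noncomputable def lyapunov (γ : Fin N → ℝ) (S : Finset (Fin N)) (q x : Fin N → ℝ) : ℝ :=
  ∑ i ∈ Sᶜ, γ i * ((1 - q i) * relEntropy ((1 - x i) / (1 - q i)))

section

variable {γ : Fin N → ℝ} {S : Finset (Fin N)} {q x : Fin N → ℝ}

lemma lyapunov_term_nonneg (hγ : ∀ i, 0 < γ i) {i : Fin N} (hq : q i < 1) (hx : x i < 1) :
    0 ≤ γ i * ((1 - q i) * relEntropy ((1 - x i) / (1 - q i))) :=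
  mul_nonneg (hγ i).le (mul_nonneg (sub_pos.2 hq).le
    (relEntropy_nonneg (div_pos (sub_pos.2 hx) (sub_pos.2 hq))))

lemma lyapunov_nonneg (hγ : ∀ i, 0 < γ i) (hq : ∀ i ∉ S, q i < 1) (hx : ∀ i ∉ S, x i < 1) :
    0 ≤ lyapunov γ S q x :=
  Finset.sum_nonneg fun i hi =>
    lyapunov_term_nonneg hγ (hq i (Finset.mem_compl.1 hi)) (hx i (Finset.mem_compl.1 hi))

lemma relEntropy_le_lyapunov (hγ : ∀ i, 0 < γ i) (hq : ∀ i ∉ S, q i < 1) (hx : ∀ i ∉ S, x i < 1)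
    {i : Fin N} (hi : i ∉ S) :
    relEntropy ((1 - x i) / (1 - q i)) ≤ lyapunov γ S q x / (γ i * (1 - q i)) := by
  rw [le_div_iff₀ (mul_pos (hγ i) (sub_pos.2 (hq i hi)))]
  have h := Finset.single_le_sum (f := fun i =>
    γ i * ((1 - q i) * relEntropy ((1 - x i) / (1 - q i))))
    (fun j hj => lyapunov_term_nonneg hγ (hq j (Finset.mem_compl.1 hj))
      (hx j (Finset.mem_compl.1 hj))) (Finset.mem_compl.2 hi)
  calc _ = γ i * ((1 - q i) * relEntropy ((1 - x i) / (1 - q i))) := by ring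
    _ ≤ _ := h

end

lemma hasDerivWithinAt_lyapunov {E : Matrix (Fin N) (Fin N) ℝ} {x : ℝ → Fin N → ℝ}
    (hx : IsSolution E x) {S : Finset (Fin N)} (γ : Fin N → ℝ) {q : Fin N → ℝ}
    (hS : ∀ i ∈ S, q i = 1) (hq : ∀ i ∉ S, q i < 1) (hEq : ∀ i ∉ S, (E *ᵥ q) i = 0)
    (hx1 : ∀ i ∈ S, x 0 i = 1) (hx0 : ∀ i ∉ S, x 0 i < 1) {t : ℝ} (ht : 0 ≤ t) :
    HasDerivWithinAt (fun s => lyapunov γ S q (x s))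
      (1 / 2 * ∑ i, γ i * (x t - q) i * (E *ᵥ (x t - q)) i) (Set.Ici 0) t := by
  have hsum : 1 / 2 * ∑ i, γ i * (x t - q) i * (E *ᵥ (x t - q)) i =
      ∑ i ∈ Sᶜ, 1 / 2 * (γ i * (x t i - q i) * (E *ᵥ x t) i) := by
    rw [Finset.mul_sum]
    symm
    apply Finset.sum_subset_zero_on_sdiff (Finset.subset_univ _)
    · intro i hi
      have hi' : i ∈ S := by simpa using hi
      simp [hS i hi', hx.eq_one (hx1 i hi') ht]
    · intro i hi
      rw [mulVec_sub, Pi.sub_apply, Pi.sub_apply, hEq i (Finset.mem_compl.1 hi), sub_zero]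
  rw [hsum]
  refine HasDerivWithinAt.fun_sum fun i hi => ?_
  have hi' : i ∉ S := Finset.mem_compl.1 hi
  have hq1 : 0 < 1 - q i := sub_pos.2 (hq i hi')
  have hxt : 0 < 1 - x t i := sub_pos.2 (hx.lt_one (hx0 i hi') ht)
  have h1 := ((hx.hasDerivWithinAt_apply ht i).const_sub 1).div_const (1 - q i)
  have h2 := (((h1.sub_const 1).sub (h1.log (div_pos hxt hq1).ne')).const_mul (1 - q i)).const_mul
    (γ i)
  refine h2.congr_deriv ?_
  field_simp
  ring

/-! ### Convergence to an equilibrium -/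

/-- A nonnegative antitone function whose derivative is `-w` has `w` small at arbitrarily late
times. -/
lemma exists_lt_of_deriv_neg {V w : ℝ → ℝ} (hV : ∀ t, 0 ≤ t → 0 ≤ V t)
    (hd : ∀ t, 0 ≤ t → HasDerivWithinAt V (-w t) (Set.Ici 0) t) {ε : ℝ} (hε : 0 < ε)
    {T : ℝ} (hT : 0 ≤ T) : ∃ t, T ≤ t ∧ w t < ε := by
  by_contra! hcon
  have hanti : AntitoneOn (fun t => V t + ε * t) (Set.Ici T) := by
    have hd' : ∀ t ∈ Set.Ici T, HasDerivWithinAt (fun t => V t + ε * t) (-w t + ε * 1)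
        (Set.Ici T) t := fun t ht =>
      ((hd t (hT.trans ht)).mono (Set.Ici_subset_Ici.2 hT)).add
        ((hasDerivWithinAt_id t _).const_mul ε)
    refine antitoneOn_of_hasDerivWithinAt_nonpos (convex_Ici T)
      (fun t ht => (hd' t ht).continuousWithinAt)
      (fun t ht => (hd' t (interior_subset ht)).mono interior_subset) fun t ht => ?_
    have := hcon t (interior_subset ht)
    linarith
  have hlarge : T ≤ T + (V T + 1) / ε :=
    le_add_of_nonneg_right (div_nonneg (by linarith [hV T hT]) hε.le)
  have h1 := hanti (Set.mem_Ici.2 le_rfl) (Set.mem_Ici.2 hlarge) hlarge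
  have h2 := hV _ (hT.trans hlarge)
  have h3 : ε * ((V T + 1) / ε) = V T + 1 := by field_simp
  simp only [mul_add, h3] at h1
  linarith

/-- Every solution starting on the face `x = 1` over `S`, and below `1` elsewhere, converges to an
equilibrium in the same face, at a difference from the given equilibrium `p` that lies in the
kernel of `E`. A limit point of the solution along times at which the dissipation tends to zero is
such an equilibrium, and the Lyapunov function centred at it forces convergence. -/
theorem IsSolution.exists_tendsto {E : Matrix (Fin N) (Fin N) ℝ} {x : ℝ → Fin N → ℝ}
    (hx : IsSolution E x) {γ : Fin N → ℝ} (hγ : ∀ i, 0 < γ i)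
    (hneg : NegSemidef (symPart (diagonal γ * E)))
    (hrank : (symPart (diagonal γ * E)).rank = E.rank)
    {S : Finset (Fin N)} {p : Fin N → ℝ}
    (hS : ∀ i ∈ S, p i = 1) (hp : ∀ i ∉ S, p i < 1) (hEp : ∀ i ∉ S, (E *ᵥ p) i = 0)
    (hx1 : ∀ i ∈ S, x 0 i = 1) (hx0 : ∀ i ∉ S, x 0 i < 1) :
    ∃ q : Fin N → ℝ, E *ᵥ (q - p) = 0 ∧ (∀ i ∈ S, q i = 1) ∧ (∀ i ∉ S, q i < 1) ∧
      Tendsto x atTop (𝓝 q) := by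
  have hxlt : ∀ t, 0 ≤ t → ∀ i ∉ S, x t i < 1 := fun t ht i hi => hx.lt_one (hx0 i hi) ht
  have hanti : ∀ q : Fin N → ℝ, (∀ i ∈ S, q i = 1) → (∀ i ∉ S, q i < 1) →
      (∀ i ∉ S, (E *ᵥ q) i = 0) → AntitoneOn (fun t => lyapunov γ S q (x t)) (Set.Ici 0) := by
    intro q h1 h2 h3
    have hd := fun t (ht : t ∈ Set.Ici (0 : ℝ)) =>
      hasDerivWithinAt_lyapunov hx γ h1 h2 h3 hx1 hx0 ht
    refine antitoneOn_of_hasDerivWithinAt_nonpos (convex_Ici 0)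
      (fun t ht => (hd t ht).continuousWithinAt)
      (fun t ht => (hd t (interior_subset ht)).mono interior_subset) fun t _ => ?_
    have := sum_weighted_nonpos hneg (x t - q)
    linarith
  -- The dissipation rate of the Lyapunov function centred at `p`.
  set W : (Fin N → ℝ) → ℝ := fun z => -(1 / 2 * ∑ i, γ i * (z - p) i * (E *ᵥ (z - p)) i) with hW
  have hWc : Continuous W := by
    have hE : Continuous fun z : Fin N → ℝ => E *ᵥ (z - p) :=
      Continuous.matrix_mulVec continuous_const (by fun_prop)
    refine (continuous_const.mul (continuous_finsetSum _ fun i _ => ?_)).neg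
    exact (continuous_const.mul ((continuous_apply i).comp (by fun_prop))).mul
      ((continuous_apply i).comp hE)
  have hW0 : ∀ z, 0 ≤ W z := fun z => by
    have := sum_weighted_nonpos hneg (z - p)
    simp only [hW]
    linarith
  have htimes : ∀ n : ℕ, ∃ t : ℝ, (n : ℝ) ≤ t ∧ W (x t) < 1 / ((n : ℝ) + 1) := fun n =>
    exists_lt_of_deriv_neg (V := fun t => lyapunov γ S p (x t)) (w := fun t => W (x t))
      (fun t ht => lyapunov_nonneg hγ hp (hxlt t ht))
      (fun t ht => (hasDerivWithinAt_lyapunov hx γ hS hp hEp hx1 hx0 ht).congr_deriv (by simp [hW]))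
      (by positivity) (by positivity)
  choose τ hτ hWτ using htimes
  have hτ0 : ∀ n, 0 ≤ τ n := fun n => (Nat.cast_nonneg n).trans (hτ n)
  have hWlim : Tendsto (fun n => W (x (τ n))) atTop (𝓝 0) :=
    squeeze_zero (fun n => hW0 _) (fun n => (hWτ n).le) tendsto_one_div_add_atTop_nhds_zero_nat
  -- The solution stays in a compact box that avoids `xᵢ = 1` for `i ∉ S`.
  set m : Fin N → ℝ := fun i => lyapunov γ S p (x 0) / (γ i * (1 - p i)) with hm
  set lo : Fin N → ℝ := fun i => if i ∈ S then 1 else 1 - (1 - p i) * (1 + √(m i)) ^ 2 with hlo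
  set hi : Fin N → ℝ := fun i => if i ∈ S then 1 else 1 - (1 - p i) * Real.exp (-(m i + 1))
    with hhi
  have hbox : ∀ t, 0 ≤ t → x t ∈ Set.Icc lo hi := by
    intro t ht
    have key : ∀ i, lo i ≤ x t i ∧ x t i ≤ hi i := by
      intro i
      by_cases hiS : i ∈ S
      · simp [hlo, hhi, hiS, hx.eq_one (hx1 i hiS) ht]
      · have hp1 : 0 < 1 - p i := sub_pos.2 (hp i hiS)
        have hle : relEntropy ((1 - x t i) / (1 - p i)) ≤ m i :=
          (relEntropy_le_lyapunov hγ hp (hxlt t ht) hiS).trans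
            (div_le_div_of_nonneg_right
              (hanti p hS hp hEp (Set.mem_Ici.2 le_rfl) (Set.mem_Ici.2 ht) ht)
              (mul_pos (hγ i) hp1).le)
        have hmem := mem_Icc_of_relEntropy_le
          (div_pos (sub_pos.2 (hxlt t ht i hiS)) hp1) hle
        have h1 := (le_div_iff₀ hp1).1 hmem.1
        have h2 := (div_le_iff₀ hp1).1 hmem.2
        simp only [hlo, hhi, hiS, if_false]
        constructor <;> linarith
    exact ⟨fun i => (key i).1, fun i => (key i).2⟩
  obtain ⟨q, hq, ψ, hψ, hlim⟩ := isCompact_Icc.tendsto_subseq fun n => hbox (τ n) (hτ0 n)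
  have hqS : ∀ i ∈ S, q i = 1 := fun i hiS => by
    have h1 := hq.1 i
    have h2 := hq.2 i
    simp only [hlo, hhi, hiS, if_true] at h1 h2
    exact le_antisymm h2 h1
  have hq1 : ∀ i ∉ S, q i < 1 := fun i hiS => by
    have h2 := hq.2 i
    simp only [hhi, hiS, if_false] at h2
    have := mul_pos (sub_pos.2 (hp i hiS)) (Real.exp_pos (-(m i + 1)))
    linarith
  have hWq : W q = 0 :=
    tendsto_nhds_unique ((hWc.tendsto q).comp hlim) (hWlim.comp hψ.tendsto_atTop)
  have hEqp : E *ᵥ (q - p) = 0 :=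
    mulVec_eq_zero_of_sum_weighted_eq_zero hneg hrank (by
      simp only [hW] at hWq
      linarith)
  have hEq : ∀ i ∉ S, (E *ᵥ q) i = 0 := fun i hiS => by
    have h := congrFun hEqp i
    rw [mulVec_sub, Pi.sub_apply, hEp i hiS, sub_zero] at h
    exact h
  refine ⟨q, hEqp, hqS, hq1, ?_⟩
  have hLcont : ContinuousAt (lyapunov γ S q) q := by
    unfold lyapunov relEntropy
    refine tendsto_finsetSum _ fun i hiS => ?_
    have hne : 1 - q i ≠ 0 := (sub_pos.2 (hq1 i (Finset.mem_compl.1 hiS))).ne'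
    have hc : ContinuousAt (fun z : Fin N → ℝ => (1 - z i) / (1 - q i)) q :=
      (continuousAt_const.sub (continuous_apply i).continuousAt).div_const _
    have hc' := hc.log (div_ne_zero hne hne)
    exact continuousAt_const.mul (continuousAt_const.mul ((hc.sub continuousAt_const).sub hc'))
  have hLq : lyapunov γ S q q = 0 := Finset.sum_eq_zero fun i hiS => by
    have hne : 1 - q i ≠ 0 := (sub_pos.2 (hq1 i (Finset.mem_compl.1 hiS))).ne'
    simp [relEntropy, div_self hne]
  have hLseq : Tendsto (fun n => lyapunov γ S q (x (τ (ψ n)))) atTop (𝓝 0) := by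
    have h := hLcont.tendsto.comp hlim
    rwa [hLq] at h
  have hL : Tendsto (fun t => lyapunov γ S q (x t)) atTop (𝓝 0) := by
    rw [Metric.tendsto_atTop]
    intro ε hε
    obtain ⟨n, hn⟩ := (hLseq.eventually (gt_mem_nhds hε)).exists
    refine ⟨τ (ψ n), fun t ht => ?_⟩
    have ht0 : 0 ≤ t := (hτ0 _).trans ht
    rw [Real.dist_eq, sub_zero, abs_of_nonneg (lyapunov_nonneg hγ hq1 (hxlt t ht0))]
    exact (hanti q hqS hq1 hEq (Set.mem_Ici.2 (hτ0 _)) (Set.mem_Ici.2 ht0) ht).trans_lt hn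
  rw [tendsto_pi_nhds]
  intro i
  by_cases hiS : i ∈ S
  · rw [hqS i hiS]
    exact tendsto_const_nhds.congr'
      ((eventually_ge_atTop 0).mono fun t ht => (hx.eq_one (hx1 i hiS) ht).symm)
  · have hqi : 0 < 1 - q i := sub_pos.2 (hq1 i hiS)
    have hpos : ∀ᶠ t in atTop, 0 < (1 - x t i) / (1 - q i) :=
      (eventually_ge_atTop 0).mono fun t ht => div_pos (sub_pos.2 (hxlt t ht i hiS)) hqi
    have hg : Tendsto (fun t => relEntropy ((1 - x t i) / (1 - q i))) atTop (𝓝 0) := by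
      have h := hL.div_const (γ i * (1 - q i))
      rw [zero_div] at h
      exact tendsto_of_tendsto_of_tendsto_of_le_of_le' tendsto_const_nhds h
        (hpos.mono fun t ht => relEntropy_nonneg ht)
        ((eventually_ge_atTop 0).mono fun t ht =>
          relEntropy_le_lyapunov hγ hq1 (hxlt t ht) hiS)
    have hu := ((tendsto_one_of_relEntropy hpos hg).mul_const (1 - q i)).const_sub 1
    rw [one_mul, sub_sub_cancel] at hu
    refine hu.congr fun t => ?_
    rw [div_mul_cancel₀ _ hqi.ne', sub_sub_cancel]

/-! ### The partially frozen equilibrium -/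

lemma mulVec_apply_eq_blocks (E : Matrix (Fin N) (Fin N) ℝ) (S : Finset (Fin N))
    (x : Fin N → ℝ) (i : {i : Fin N // i ∉ S}) :
    (E *ᵥ x) i = (freeBlock E S *ᵥ fun j => x j) i + (couplingBlock E S *ᵥ fun j => x j) i := by
  simp only [mulVec, dotProduct, freeBlock, couplingBlock, toBlock_apply]
  rw [add_comm]
  convert (Fintype.sum_subtype_add_sum_subtype (fun j => j ∈ S) fun j => E i j * x j).symm

lemma mulVec_frozenEquilibrium (E : Matrix (Fin N) (Fin N) ℝ) (S : Finset (Fin N))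
    (hdet : (freeBlock E S).det ≠ 0) {i : Fin N} (hi : i ∉ S) :
    (E *ᵥ frozenEquilibrium E S) i = 0 := by
  have h1 : (fun j : {i : Fin N // i ∉ S} => frozenEquilibrium E S j) = freeEquilibrium E S := by
    funext j
    simp [frozenEquilibrium, j.2]
  have h2 : (fun j : {i : Fin N // i ∈ S} => frozenEquilibrium E S j) = fun _ => 1 := by
    funext j
    simp [frozenEquilibrium, j.2]
  have h := mulVec_apply_eq_blocks E S (frozenEquilibrium E S) ⟨i, hi⟩
  rw [h1, h2, freeEquilibrium, mulVec_neg, mulVec_mulVec,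
    mul_nonsing_inv _ (isUnit_iff_ne_zero.2 hdet), one_mulVec, Pi.neg_apply,
    neg_add_cancel] at h
  exact h

lemma eq_zero_of_freeBlock {E : Matrix (Fin N) (Fin N) ℝ} {S : Finset (Fin N)}
    (hdet : (freeBlock E S).det ≠ 0) {y : Fin N → ℝ} (hyS : ∀ i ∈ S, y i = 0)
    (hy : E *ᵥ y = 0) : y = 0 := by
  have h0 : (fun j : {i : Fin N // i ∈ S} => y j) = 0 := funext fun j => hyS j j.2
  have h1 : (freeBlock E S *ᵥ fun j => y j) = 0 := by
    funext i
    have h := mulVec_apply_eq_blocks E S y i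
    rw [h0, mulVec_zero, hy] at h
    simpa using h.symm
  have h2 := eq_zero_of_mulVec_eq_zero hdet h1
  funext i
  by_cases hi : i ∈ S
  · exact hyS i hi
  · exact congrFun h2 ⟨i, hi⟩

/-- Under either assumption `E = C - d I` with `C` eventually positive and `d ≥ ρ(C)`. -/
lemma eventuallyPositive_shift [NeZero N] {B C : Matrix (Fin N) (Fin N) ℝ} {σ : Fin N → ℝ} {d : ℝ}
    (h : (Assumption1 B σ ∧ C = B ∧ ∀ i, σ i = d) ∨ Assumption2 B σ C d) :
    EventuallyPositive C ∧ specRadius C ≤ d ∧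
      systemMatrix B σ = C - d • (1 : Matrix (Fin N) (Fin N) ℝ) := by
  rcases h with ⟨⟨hB, hσB⟩, rfl, hd⟩ | ⟨-, hC, hpos, hle⟩
  · refine ⟨hB, hd 0 ▸ (hσB 0 0).2, ?_⟩
    rw [systemMatrix, show σ = fun _ => d from funext hd, smul_one_eq_diagonal]
  · refine ⟨hpos, hle, ?_⟩
    rw [systemMatrix, hC]
    abel

end OpinionDynamics

/-- The stubborn positives scenario. The matrix `C` and the number `d` are those of the second
assumption; under the first one `C = B` and `d` is the common value of the `σ i`. -/
theorem theorem1 {N : ℕ} (hN : 1 ≤ N)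
    (B : Matrix (Fin N) (Fin N) ℝ) (σ : Fin N → ℝ)
    (hdiag : ∀ i, B i i = 0) (hσ : ∀ i, 0 < σ i) (hconn : StronglyConnected B)
    (C : Matrix (Fin N) (Fin N) ℝ) (d : ℝ)
    (hassumption : (Assumption1 B σ ∧ C = B ∧ ∀ i, σ i = d) ∨ Assumption2 B σ C d)
    (hΓ : ∃ γ : Fin N → ℝ, (∀ i, 0 < γ i) ∧
      NegSemidef (symPart (Matrix.diagonal γ * systemMatrix B σ)) ∧
      (symPart (Matrix.diagonal γ * systemMatrix B σ)).rank = (systemMatrix B σ).rank) :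
    -- 1) convergence from below `𝟏`
    (∀ v : Fin N → ℝ, IsPerronVector C v →
      ∀ x : ℝ → Fin N → ℝ, IsSolution (systemMatrix B σ) x → (∀ i, x 0 i < 1) →
        ∃ α : ℝ, Tendsto x atTop (𝓝 (α • v)) ∧ α < 1 / ‖v‖ ∧
          ((∀ t : ℝ, 0 ≤ t → ∀ i, x t i ∈ Set.Icc (-1 : ℝ) 1) → -(1 / ‖v‖) ≤ α)) ∧
    -- 2) convergence with the components in `S` frozen at `1`
    (∀ S : Finset (Fin N), S.Nonempty → (∃ i, i ∉ S) →
      (freeBlock (systemMatrix B σ) S).det ≠ 0 →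
      (∀ i, -1 ≤ freeEquilibrium (systemMatrix B σ) S i ∧
        freeEquilibrium (systemMatrix B σ) S i < 1) →
      opinionField (systemMatrix B σ) (frozenEquilibrium (systemMatrix B σ) S) = 0 ∧
      ∀ x : ℝ → Fin N → ℝ, IsSolution (systemMatrix B σ) x →
        (∀ i ∈ S, x 0 i = 1) → (∀ i ∉ S, x 0 i ∈ Set.Ico (-1 : ℝ) 1) →
        Tendsto x atTop (𝓝 (frozenEquilibrium (systemMatrix B σ) S))) ∧
    -- 3) the critical case
    (d = specRadius C → ∀ v : Fin N → ℝ, IsPerronVector C v → v ≠ 1 →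
      ∀ x : ℝ → Fin N → ℝ, IsSolution (systemMatrix B σ) x →
        (∀ j, v j = ‖v‖ → x 0 j = 1) → (∀ j, v j ≠ ‖v‖ → x 0 j ∈ Set.Ico (-1 : ℝ) 1) →
        Tendsto x atTop (𝓝 ((1 / ‖v‖) • v))) := by
  have : NeZero N := ⟨by omega⟩
  obtain ⟨γ, hγ, hneg, hrank⟩ := hΓ
  obtain ⟨hC, hρ, hE⟩ := eventuallyPositive_shift hassumption
  have hρ0 : 0 ≤ specRadius C := ENNReal.toReal_nonneg
  have hnorm : ∀ v : Fin N → ℝ, IsPerronVector C v → 0 < ‖v‖ := fun v hv =>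
    (hv.1 0).trans_le ((le_abs_self _).trans (norm_le_pi_norm v 0))
  have hattain : ∀ v : Fin N → ℝ, IsPerronVector C v → ∃ j, v j = ‖v‖ := fun v hv => by
    obtain ⟨j, hj⟩ := Finite.exists_max v
    refine ⟨j, le_antisymm ((le_abs_self _).trans (norm_le_pi_norm v j))
      ((pi_norm_le_iff_of_nonneg (hv.1 j).le).2 fun i => ?_)⟩
    rw [Real.norm_of_nonneg (hv.1 i).le]
    exact hj i
  have hker : ∀ v : Fin N → ℝ, IsPerronVector C v → ∀ y : Fin N → ℝ,
      (systemMatrix B σ).mulVec y = 0 → ∃ α : ℝ, y = α • v := fun v hv y hy => by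
    refine hC.exists_eq_smul hρ0 hρ hv.1 hv.2 ?_
    rwa [hE, Matrix.sub_mulVec, Matrix.smul_mulVec, Matrix.one_mulVec, sub_eq_zero] at hy
  refine ⟨?_, ?_, ?_⟩
  · intro v hv x hx hx0
    obtain ⟨q, hq, -, hq1, hlim⟩ := hx.exists_tendsto hγ hneg hrank (S := ∅) (p := 0)
      (by simp) (by simp) (by simp) (by simp) fun i _ => hx0 i
    rw [sub_zero] at hq
    obtain ⟨α, rfl⟩ := hker v hv q hq
    obtain ⟨j, hj⟩ := hattain v hv
    refine ⟨α, hlim, ?_, fun hbd => ?_⟩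
    · rw [lt_div_iff₀ (hnorm v hv), ← hj]
      simpa using hq1 j (by simp)
    · have hge : -1 ≤ (α • v) j := ge_of_tendsto (tendsto_pi_nhds.1 hlim j)
        ((eventually_ge_atTop 0).mono fun t ht => (hbd t ht j).1)
      rw [Pi.smul_apply, smul_eq_mul, hj] at hge
      rw [← neg_div, div_le_iff₀ (hnorm v hv)]
      exact hge
  · intro S _ _ hdet hfree
    have hone : ∀ i ∈ S, frozenEquilibrium (systemMatrix B σ) S i = 1 := fun i hi => by
      simp [frozenEquilibrium, hi]
    have hlt : ∀ i ∉ S, frozenEquilibrium (systemMatrix B σ) S i < 1 := fun i hi => by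
      simpa [frozenEquilibrium, hi] using (hfree ⟨i, hi⟩).2
    have hzero := fun i (hi : i ∉ S) => mulVec_frozenEquilibrium (systemMatrix B σ) S hdet hi
    refine ⟨funext fun i => ?_, fun x hx hx1 hx0 => ?_⟩
    · rw [opinionField_apply]
      by_cases hi : i ∈ S
      · simp [hone i hi]
      · simp [hzero i hi]
    · obtain ⟨q, hq, hqS, -, hlim⟩ := hx.exists_tendsto hγ hneg hrank hone hlt hzero hx1
        fun i hi => (hx0 i hi).2
      have h := eq_zero_of_freeBlock hdet (fun i hi => by simp [hqS i hi, hone i hi]) hq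
      rwa [sub_eq_zero.1 h] at hlim
  · intro hd v hv _ x hx hx1 hx0
    -- The proof covers constant `v` as well: then every coordinate is frozen.
    have hv0 := hnorm v hv
    set S : Finset (Fin N) := Finset.univ.filter fun j => v j = ‖v‖ with hS
    have hmem : ∀ j, j ∈ S ↔ v j = ‖v‖ := fun j => by simp [hS]
    set p : Fin N → ℝ := (1 / ‖v‖) • v with hp
    have hpS : ∀ i ∈ S, p i = 1 := fun i hi => by
      simp [hp, (hmem i).1 hi, hv0.ne']
    have hplt : ∀ i ∉ S, p i < 1 := fun i hi => by
      have hlt : v i < ‖v‖ := lt_of_le_of_ne ((le_abs_self _).trans (norm_le_pi_norm v i))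
        fun h => hi ((hmem i).2 h)
      rw [hp, Pi.smul_apply, smul_eq_mul, one_div_mul_eq_div, div_lt_one hv0]
      exact hlt
    have hEp : (systemMatrix B σ).mulVec p = 0 := by
      rw [hp, Matrix.mulVec_smul, hE, Matrix.sub_mulVec, hv.2, Matrix.smul_mulVec,
        Matrix.one_mulVec, hd, sub_self, smul_zero]
    obtain ⟨q, hq, hqS, -, hlim⟩ := hx.exists_tendsto hγ hneg hrank hpS hplt
      (fun i _ => by rw [hEp, Pi.zero_apply]) (fun i hi => hx1 i ((hmem i).1 hi))
      fun i hi => (hx0 i fun h => hi ((hmem i).2 h)).2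
    -- `q - p` is a multiple of the positive vector `v` that vanishes where `v` is largest.
    obtain ⟨α, hα⟩ := hker v hv _ hq
    obtain ⟨j, hj⟩ := hattain v hv
    have hjS := (hmem j).2 hj
    have hαj := congrFun hα j
    rw [Pi.sub_apply, hqS j hjS, hpS j hjS, sub_self, Pi.smul_apply, smul_eq_mul] at hαj
    have hα0 : α = 0 := (mul_eq_zero.1 hαj.symm).resolve_right (hv.1 j).ne'
    rw [hα0, zero_smul, sub_eq_zero] at hα
    rwa [hα] at hlim
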